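/- Fix a radial, nonnegative Schwartz function $\hat\rho:\mathbb{R}^2\to[0,\infty)$ with $\hat\rho(\xi)=0$ for $|\xi|\le 1-\tfrac17$ and for $|\xi|\ge 2+\tfrac17$, and $\sum_{j\in\mathbb{Z}}\hat\rho(2^{-j}\xi)=1$ for all $\xi\neq 0$; put $\hat\rho_{(0)}(\xi)=\sum_{j\le 0}\hat\rho(2^{-j}\xi)$ for $\xi\ne0$ and $\hat\rho_{(0)}(0)=1$. Let $F$ be a complex Banach space (for instance $\mathbb{C}$ or $\mathbb{C}^2$). For an $F$-valued tempered distribution $f$ on $\mathbb{R}^2$ put $f_{(0)}=\mathscr{F}^{-1}(\hat\rho_{(0)}\hat f)$ and $f_{(j)}=\mathscr{F}^{-1}(\hat\rho(2^{-j}\cdot)\hat f)$ for $j\ge1$, where $\hat f(\xi)=\int e^{-ix\cdot\xi}f(x)\,dx$, and $$\|f\|_{B^s_{1,\infty}}=\|f_{(0)}\|_{L^1}+\sup_{j\ge1}2^{js}\|f_{(j)}\|_{L^1},$$ where the $L^p$ norm of a tempered distribution that is not an $L^p$ function is $+\infty$. Let $B^s_{1,\infty}(\mathbb{R}^2)$ be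 the space of those $f$ for which this is finite. The operators $(b-\Delta)^{-1}$ and $(1-\Delta)^{s/2}$ act on tempered distributions as the Fourier multipliers $(b+|\xi|^2)^{-1}$ and $(1+|\xi|^2)^{s/2}$. Then for all $b>0$ and $s>0$ there is a constant $C>0$, depending only on $b$, $s$ (and on the fixed $\hat\rho$ and $F$), such that every $f\in B^s_{1,\infty}(\mathbb{R}^2)$ belongs to $L^1(\mathbb{R}^2)$ and satisfies $$\|(b-\Delta)^{-1}f\|_{L^\infty}\le C\,\|f\|_{L^1}\log\Bigl(2+\frac{\|f\|_{B^s_{1,\infty}}}{\|f\|_{L^1}}\Bigr),$$ and, if moreover $s\le 2$ (so that $2/s\ge 1$), $$\|(b-\Delta)^{-1}f\|_{L^\infty}+\|(b-\Delta)^{-1}(1-\Delta)^{s/2}f\|_{L^{2/s}}\le C\,\|f\|_{L^1}\log\Bigl(2+\frac{\|f\|_{B^s_{1,\infty}}}{\|f\|_{L^1}}\Bigr).$$ For $f=0$ the right-hand sides are read as $0$. -/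

import Mathlib

open MeasureTheory Function
open scoped SchwartzMap ENNReal

noncomputable section

namespace BrezisGallouet

/-- The Euclidean plane. -/
abbrev Plane : Type := EuclideanSpace ℝ (Fin 2)

/-- A dyadic Littlewood–Paley cutoff on the frequency plane: a radial nonnegative Schwartz function
supported in the annulus `1 - 1/7 ≤ |ξ| ≤ 2 + 1/7`, whose dyadic dilates sum to `1` off the origin
(the sum vanishes at the origin). -/
structure DyadicCutoff where
  /-- the underlying Schwartz function -/
  toSchwartz : 𝓢(Plane, ℝ)
  radial : ∀ ξ η : Plane, ‖ξ‖ = ‖η‖ → toSchwartz ξ = toSchwartz η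
  nonneg : ∀ ξ : Plane, 0 ≤ toSchwartz ξ
  eq_zero_of_le : ∀ ξ : Plane, ‖ξ‖ ≤ 1 - 1 / 7 → toSchwartz ξ = 0
  eq_zero_of_ge : ∀ ξ : Plane, 2 + 1 / 7 ≤ ‖ξ‖ → toSchwartz ξ = 0
  hasSum_one : ∀ ξ : Plane, ξ ≠ 0 → HasSum (fun j : ℤ => toSchwartz ((2 : ℝ) ^ (-j) • ξ)) 1

/-- The annular cutoff at frequency `2 ^ j`, that is `ξ ↦ ρ (2 ^ (-j) ξ)`. -/
def DyadicCutoff.annulus (ρ : DyadicCutoff) (j : ℕ) (ξ : Plane) : ℝ :=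
  ρ.toSchwartz ((2 : ℝ) ^ (-(j : ℤ)) • ξ)

open Classical in
/-- The low-frequency cutoff `ξ ↦ ∑_{j ≤ 0} ρ (2 ^ (-j) ξ)`, extended continuously to the origin
by the value `1`. -/
def DyadicCutoff.low (ρ : DyadicCutoff) (ξ : Plane) : ℝ :=
  if ξ = 0 then 1 else ∑' k : ℕ, ρ.toSchwartz ((2 : ℝ) ^ k • ξ)

/-- Dyadic cutoffs exist. -/
theorem nonempty_dyadicCutoff : Nonempty DyadicCutoff := by
  let χ : Plane → ℝ := fun ξ => Real.smoothTransition ((1 - ‖ξ‖^2) * (49/13))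
  have χs : ContDiff ℝ (⊤ : ℕ∞) χ := by
    apply Real.smoothTransition.contDiff.comp
    exact (contDiff_const.sub (contDiff_norm_sq ℝ)).mul contDiff_const
  have χ1 : ∀ ξ, ‖ξ‖ ≤ 6/7 → χ ξ = 1 := fun ξ h => by
    apply Real.smoothTransition.one_of_one_le
    nlinarith [norm_nonneg ξ]
  have χ0 : ∀ ξ, 1 ≤ ‖ξ‖ → χ ξ = 0 := fun ξ h => by
    apply Real.smoothTransition.zero_of_nonpos
    nlinarith [norm_nonneg ξ]
  let r : Plane → ℝ := fun ξ => χ ((2:ℝ)⁻¹ • ξ) - χ ξ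
  have nh : ∀ ξ : Plane, ‖(2:ℝ)⁻¹ • ξ‖ = ‖ξ‖ / 2 := fun ξ => by rw [norm_smul]; norm_num; ring
  have rs : ContDiff ℝ (⊤ : ℕ∞) r := (χs.comp (contDiff_const_smul _)).sub χs
  have r0 : ∀ ξ, 2 ≤ ‖ξ‖ → r ξ = 0 := fun ξ h => by
    simp only [r]; rw [χ0 _ (by rw [nh]; linarith), χ0 _ (by linarith), sub_zero]
  have rc : HasCompactSupport r := by
    apply HasCompactSupport.intro (isCompact_closedBall (0 : Plane) 2)
    intro ξ h
    apply r0
    simpa using (not_le.mp (by simpa using h)).le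
  refine ⟨⟨rc.toSchwartzMap rs, ?_, ?_, ?_, ?_, ?_⟩⟩
  · intro ξ η h
    show r ξ = r η
    simp only [r, χ, nh, h]
  · intro ξ
    show 0 ≤ r ξ
    simp only [r, χ, nh, sub_nonneg]
    apply Real.smoothTransition.monotone
    nlinarith [norm_nonneg ξ]
  · intro ξ h
    show r ξ = 0
    simp only [r]; rw [χ1 _ (by rw [nh]; linarith [norm_nonneg ξ]), χ1 _ (by linarith), sub_self]
  · intro ξ h
    exact r0 ξ (by linarith)
  · intro ξ hξ
    show HasSum (fun j : ℤ => r ((2 : ℝ) ^ (-j) • ξ)) 1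
    have n0 : 0 < ‖ξ‖ := norm_pos_iff.mpr hξ
    have rz : ∀ j : ℤ, r ((2 : ℝ) ^ (-j) • ξ) = χ ((2:ℝ)^(-(j+1)) • ξ) - χ ((2:ℝ)^(-j) • ξ) := by
      intro j
      simp only [r, smul_smul]
      congr 3
      rw [neg_add, zpow_add₀ (by norm_num)]; norm_num; ring
    obtain ⟨N, hN1, hN2⟩ : ∃ N : ℕ, ‖ξ‖ ≤ 6/7 * 2^N ∧ 1 ≤ ‖ξ‖ * 2^N := by
      obtain ⟨a, ha⟩ := pow_unbounded_of_one_lt (‖ξ‖ * (7/6)) (one_lt_two (α := ℝ))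
      obtain ⟨c, hc⟩ := pow_unbounded_of_one_lt (‖ξ‖⁻¹) (one_lt_two (α := ℝ))
      refine ⟨max a c, ?_, ?_⟩
      · have := pow_le_pow_right₀ (one_le_two (α := ℝ)) (le_max_left a c); linarith
      · have := pow_le_pow_right₀ (one_le_two (α := ℝ)) (le_max_right a c)
        have h2 : ‖ξ‖ * ‖ξ‖⁻¹ = 1 := mul_inv_cancel₀ n0.ne'
        nlinarith
    have nz : ∀ j : ℤ, ‖(2:ℝ)^j • ξ‖ = 2^j * ‖ξ‖ := fun j => by
      rw [norm_smul, Real.norm_eq_abs, abs_of_pos (by positivity)]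
    have hi : ∀ j : ℤ, (N:ℤ) ≤ j → χ ((2:ℝ)^(-j) • ξ) = 1 := fun j hj => by
      apply χ1; rw [nz, zpow_neg, inv_mul_le_iff₀ (by positivity)]
      have := zpow_le_zpow_right₀ (one_le_two (α := ℝ)) hj
      rw [zpow_natCast] at this; linarith
    have lo : ∀ j : ℤ, j ≤ -(N:ℤ) → χ ((2:ℝ)^(-j) • ξ) = 0 := fun j hj => by
      apply χ0; rw [nz]
      have := zpow_le_zpow_right₀ (one_le_two (α := ℝ)) (show (N:ℤ) ≤ -j by omega)
      rw [zpow_natCast] at this; nlinarith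
    have tel : ∑ j ∈ Finset.Ico (-(N:ℤ)) N, r ((2 : ℝ) ^ (-j) • ξ) = 1 := by
      have gen : ∀ n : ℕ, ∑ j ∈ Finset.Ico (-(N:ℤ)) (-(N:ℤ) + n), r ((2 : ℝ) ^ (-j) • ξ)
          = χ ((2:ℝ)^(-(-(N:ℤ) + n)) • ξ) := by
        intro n
        induction n with
        | zero => simpa using (lo (-(N:ℤ)) le_rfl).symm
        | succ k ih =>
          have : Finset.Ico (-(N:ℤ)) (-(N:ℤ) + (k+1:ℕ)) = insert (-(N:ℤ)+k) (Finset.Ico (-(N:ℤ)) (-(N:ℤ) + k)) := by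
            ext x; simp only [Finset.mem_Ico, Finset.mem_insert]; push_cast; omega
          rw [this, Finset.sum_insert (by simp), ih, rz]
          push_cast
          rw [← add_assoc]; try ring
      have := gen (2*N)
      rw [show -(N:ℤ) + ((2*N:ℕ):ℤ) = N by push_cast; ring] at this
      rw [this, hi _ le_rfl]
    rw [← tel]
    apply hasSum_sum_of_ne_finset_zero
    intro j hj
    rw [rz]
    rw [Finset.mem_Ico, not_and_or, not_le, not_lt] at hj
    rcases hj with hj | hj
    · rw [lo _ (by omega), lo _ (by omega), sub_self]
    · rw [hi _ (by omega), hi _ (by omega), sub_self]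

/-! The cutoffs are smooth with temperate growth, hence legitimate multipliers. -/

theorem DyadicCutoff.low_one (ρ : DyadicCutoff) (ξ : Plane) (h : ‖ξ‖ ≤ 12/7) : ρ.low ξ = 1 := by
  unfold DyadicCutoff.low
  split_ifs with h0
  · rfl
  have inj : Function.Injective (fun k : ℕ => -(k:ℤ)) := fun a b h => by simpa using h
  have := (inj.hasSum_iff (f := fun j : ℤ => ρ.toSchwartz ((2 : ℝ) ^ (-j) • ξ)) (a := 1) ?_).mpr (ρ.hasSum_one ξ h0)
  · simpa [Function.comp_def] using this.tsum_eq
  · intro j hj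
    apply ρ.eq_zero_of_le
    have hj : 1 ≤ j := by
      by_contra hh
      exact hj ⟨j.natAbs, by show -((j.natAbs:ℕ):ℤ) = j; omega⟩
    rw [norm_smul, Real.norm_eq_abs, abs_of_pos (by positivity)]
    have := zpow_le_zpow_right₀ (one_le_two (α := ℝ)) (show -j ≤ -1 by omega)
    norm_num at this ⊢
    nlinarith [norm_nonneg ξ]

theorem DyadicCutoff.low_eq (ρ : DyadicCutoff) (ξ : Plane) (h : 15/14 ≤ ‖ξ‖) : ρ.low ξ = ρ.toSchwartz ξ := by
  unfold DyadicCutoff.low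
  rw [if_neg (by rintro rfl; norm_num at h)]
  rw [tsum_eq_single 0]
  · simp
  · intro k hk
    apply ρ.eq_zero_of_ge
    rw [norm_smul, Real.norm_eq_abs, abs_of_pos (by positivity)]
    have := pow_le_pow_right₀ (one_le_two (α := ℝ)) (Nat.one_le_iff_ne_zero.mpr hk)
    nlinarith

theorem DyadicCutoff.low_hasTemperateGrowth (ρ : DyadicCutoff) : ρ.low.HasTemperateGrowth := by
  apply HasCompactSupport.hasTemperateGrowth
  · apply HasCompactSupport.intro (isCompact_closedBall (0 : Plane) (15/7))
    intro ξ h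
    have h : 15/7 < ‖ξ‖ := by simpa using h
    rw [DyadicCutoff.low_eq ρ ξ (by linarith)]
    exact ρ.eq_zero_of_ge _ (by linarith)
  · rw [contDiff_iff_contDiffAt]
    intro ξ
    rcases lt_or_ge ‖ξ‖ (12/7) with h | h
    · refine (contDiffAt_const (c := (1:ℝ))).congr_of_eventuallyEq ?_
      filter_upwards [(isOpen_lt continuous_norm continuous_const).mem_nhds h] with x hx
      exact DyadicCutoff.low_one ρ x (le_of_lt hx)
    · refine ((ρ.toSchwartz.smooth _).contDiffAt).congr_of_eventuallyEq ?_
      filter_upwards [(isOpen_lt continuous_const continuous_norm).mem_nhds (show 15/14 < ‖ξ‖ by linarith)] with x hx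
      exact DyadicCutoff.low_eq ρ x (le_of_lt hx)

theorem DyadicCutoff.annulus_hasTemperateGrowth (ρ : DyadicCutoff) (j : ℕ) :
    (ρ.annulus j).HasTemperateGrowth := by
  have h1 : (fun ξ : Plane => (2 : ℝ) ^ (-(j : ℤ)) • ξ).HasTemperateGrowth :=
    ((2 : ℝ) ^ (-(j : ℤ)) • ContinuousLinearMap.id ℝ Plane).hasTemperateGrowth
  exact ρ.toSchwartz.hasTemperateGrowth.comp h1

variable {F : Type*} [NormedAddCommGroup F] [NormedSpace ℂ F]

/-- The operator `m(D)` on tempered distributions: multiplication by `m(ξ)` on the Fourier side,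
where `ξ` is the angular frequency, i.e. `û(ξ) = ∫ e^{- i x·ξ} u(x) dx`. Mathlib's transform uses
the kernel `e^{- 2 π i x·ξ}`, whence the factor `2 π`. -/
def multiplier (m : Plane → ℝ) : 𝓢'(Plane, F) →L[ℂ] 𝓢'(Plane, F) :=
  TemperedDistribution.fourierMultiplierCLM F (fun ξ => ((m ((2 * Real.pi) • ξ) : ℝ) : ℂ))

/-- The resolvent `(b - Δ)⁻¹` on tempered distributions, with symbol `(b + |ξ|²)⁻¹`. -/
def resolvent (b : ℝ) : 𝓢'(Plane, F) →L[ℂ] 𝓢'(Plane, F) :=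
  multiplier (fun ξ => (b + ‖ξ‖ ^ 2)⁻¹)

/-- The Bessel operator `(1 - Δ)^{s/2}` on tempered distributions, with symbol
`(1 + |ξ|²)^{s/2}`. -/
def bessel (s : ℝ) : 𝓢'(Plane, F) →L[ℂ] 𝓢'(Plane, F) :=
  multiplier (fun ξ => (1 + ‖ξ‖ ^ 2) ^ (s / 2))

/-! The symbols are smooth with temperate growth, hence legitimate multipliers. -/

theorem hasTemperateGrowth_scale {m : Plane → ℝ} (hm : m.HasTemperateGrowth) :
    (fun ξ : Plane => ((m ((2 * Real.pi) • ξ) : ℝ) : ℂ)).HasTemperateGrowth := by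
  have h1 : (fun ξ : Plane => (2 * Real.pi) • ξ).HasTemperateGrowth :=
    ((2 * Real.pi) • ContinuousLinearMap.id ℝ Plane).hasTemperateGrowth
  exact Complex.hasTemperateGrowth_ofReal.comp (hm.comp h1)

theorem bessel_symbol_hasTemperateGrowth (s : ℝ) : (fun ξ : Plane => (1 + ‖ξ‖ ^ 2) ^ (s / 2)).HasTemperateGrowth :=
  hasTemperateGrowth_one_add_norm_sq_rpow Plane (s/2)

theorem resolvent_symbol_hasTemperateGrowth {b : ℝ} (hb : 0 < b) : (fun ξ : Plane => (b + ‖ξ‖ ^ 2)⁻¹).HasTemperateGrowth := by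
  have h1 : (fun ξ : Plane => (√b)⁻¹ • ξ).HasTemperateGrowth :=
    ((√b)⁻¹ • ContinuousLinearMap.id ℝ Plane).hasTemperateGrowth
  have h2 := (HasTemperateGrowth.const (E := Plane) b⁻¹).mul
    ((hasTemperateGrowth_one_add_norm_sq_rpow Plane (-1)).comp h1)
  refine (congrArg _ (funext fun ξ => ?_)).mp h2
  simp only [Pi.mul_apply, comp_apply, norm_smul, norm_inv, Real.norm_eq_abs, abs_of_nonneg (Real.sqrt_nonneg b),
    mul_pow, inv_pow, Real.sq_sqrt hb.le]
  rw [Real.rpow_neg_one, ← mul_inv]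
  congr 1
  field_simp

open scoped Laplacian in
/-- The resolvent inverts `b - Δ`. -/
theorem resolvent_eq {b : ℝ} (hb : 0 < b) (f : 𝓢'(Plane, F)) :
    b • resolvent b f - Δ (resolvent b f) = f := by
  rw [TemperedDistribution.laplacian_eq_fourierMultiplierCLM]
  unfold resolvent multiplier
  rw [TemperedDistribution.fourierMultiplierCLM_fourierMultiplierCLM_apply (hasTemperateGrowth_scale (resolvent_symbol_hasTemperateGrowth hb)) (by fun_prop)]
  have h1 := hasTemperateGrowth_scale (resolvent_symbol_hasTemperateGrowth hb)
  have h3 : (fun x : Plane => ((‖x‖^2 : ℝ) : ℂ)).HasTemperateGrowth := by fun_prop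
  ext u
  show b • f (FourierTransform.fourier (SchwartzMap.smulLeftCLM ℂ _ (FourierTransform.fourierInv u)))
    - (-((2 * Real.pi)^2) • f (FourierTransform.fourier (SchwartzMap.smulLeftCLM ℂ _ (FourierTransform.fourierInv u)))) = f u
  set v := FourierTransform.fourierInv u with hv
  have hu : u = FourierTransform.fourier v := by simp [hv]
  rw [hu]
  rw [neg_smul, sub_neg_eq_add]
  simp only [← Complex.coe_smul]
  rw [← map_smul, ← map_smul, ← map_add, ← FourierTransform.fourier_smul, ← FourierTransform.fourier_smul, ← FourierTransform.fourier_add]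
  congr 2
  ext x
  have hx : b + ‖(2 * Real.pi) • x‖ ^ 2 ≠ 0 := by positivity
  rw [add_apply, smul_apply, smul_apply, SchwartzMap.smulLeftCLM_apply_apply h1, SchwartzMap.smulLeftCLM_apply_apply (h1.mul h3)]
  have e : b * (b + ‖(2 * Real.pi) • x‖ ^ 2)⁻¹ + (2 * Real.pi)^2 * ((b + ‖(2 * Real.pi) • x‖ ^ 2)⁻¹ * ‖x‖^2) = 1 := by
    have n : ‖(2 * Real.pi) • x‖ ^ 2 = (2 * Real.pi)^2 * ‖x‖^2 := by
      rw [norm_smul, mul_pow, Real.norm_eq_abs, sq_abs]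
    rw [n] at hx ⊢
    field_simp
  have e' := congrArg (fun t : ℝ => (t : ℂ) * v x) e
  simp only [Pi.mul_apply, smul_eq_mul]
  push_cast at e' ⊢
  linear_combination e'

/-- The tempered distribution `u` is (given by integration against) the function `g`. -/
def IsGivenBy (u : 𝓢'(Plane, F)) (g : Plane → F) : Prop :=
  LocallyIntegrable g ∧ ∀ φ : 𝓢(Plane, ℂ), Integrable (fun x => φ x • g x) ∧ u φ = ∫ x, φ x • g x

/-- The extended `L^p` norm (`1 ≤ p ≤ ∞`) of a tempered distribution: the `L^p` norm of the
function (unique almost everywhere) that represents it, and `∞` if there is none. -/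
def lpNorm (p : ℝ≥0∞) (u : 𝓢'(Plane, F)) : ℝ≥0∞ :=
  ⨅ (g : Plane → F) (_ : IsGivenBy u g), eLpNorm g p volume

/-- The extended Besov norm of `B^s_{p,∞}`:
`‖u_{(0)}‖_{L^p} + sup_{j ≥ 1} 2^{js} ‖u_{(j)}‖_{L^p}`. -/
def besovNorm (ρ : DyadicCutoff) (s : ℝ) (p : ℝ≥0∞) (u : 𝓢'(Plane, F)) : ℝ≥0∞ :=
  lpNorm p (multiplier ρ.low u) +
    ⨆ (j : ℕ) (_ : 1 ≤ j), ENNReal.ofReal ((2 : ℝ) ^ ((j : ℝ) * s)) *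
      lpNorm p (multiplier (ρ.annulus j) u)

end BrezisGallouet

end

/-!
The proof is a Littlewood–Paley decomposition `f = ∑ⱼ f_(j)` together with the uniform bound
`‖m(D) f_(j)‖_{L^p} ≤ C ‖f_(j)‖_{L^1}`, where `m(ξ) = (b + |ξ|²)⁻¹ (1 + |ξ|²)^{σ/2}` and
`1/p = σ/2`. The choice `σ = 0`, `p = ∞` gives the resolvent, and `σ = s`, `p = 2/s` gives the
resolvent composed with the Bessel operator, so both estimates are instances of
`exists_lpNorm_symbol_le_log`.

The dyadic bound (`exists_lpNorm_symbol_block_le`) is a scaling computation. On the annulus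
`|ξ| ∼ 2^j` put `t = 2⁻ʲ` and `η = tξ`; then `m(ξ) = t^{2 - σ} h_t(η)` with
`h_t(η) = (b t² + |η|²)⁻¹ (t² + |η|²)^{σ/2}` cut off to `|η| ∼ 1`. This expression is smooth jointly
in `(t, η)`, down to and including `t = 0`, so `{h_t : 0 ≤ t ≤ 1}` is bounded in the Schwartz space,
and the kernels `𝓕⁻ h_t` are bounded in `L^1` and `L^∞` uniformly in `t`. Undoing the dilation
multiplies the `L^∞` norm of the kernel by `t⁻²` and preserves its `L^1` norm; interpolating, the
`L^1 → L^p` norm of the piece is at most a constant times `t^{2 - σ} (t⁻²)^{1 - σ/2} = 1`.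

For `A = ‖f‖_{L^1}` and `B = ‖f‖_{B^s_{1,∞}}` one has `‖f_(j)‖_{L^1} ≤ K A`
(`exists_lpNorm_block_le`) and `‖f_(j)‖_{L^1} ≤ 2^{-js} B` (`lpNorm_block_le_besovNorm`). The first
bound is used for the `O(log (2 + B / A))` frequencies with `2^{js} ≤ 2 + B / A`, and the second,
a geometric series with sum `O(A)`, for the others (`tsum_le_log`).

Summation is legitimate since the partial sums of `∑ⱼ f_(j)` converge to `f` weakly
(`tendsto_sum_block`) and `L^p` is complete (`lpNorm_le_tsum`).
-/

namespace BrezisGallouet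

open Filter Topology FourierTransform Convolution

/-! ### Distributions given by functions in `L^p` -/

section

variable {F : Type*} [NormedAddCommGroup F] [NormedSpace ℂ F]

theorem IsGivenBy.aestronglyMeasurable {u : 𝓢'(Plane, F)} {g : Plane → F} (h : IsGivenBy u g) :
    AEStronglyMeasurable g volume :=
  h.1.aestronglyMeasurable

variable [CompleteSpace F]

/-- An `L^p` function represents the tempered distribution that Mathlib attaches to its class. -/
theorem isGivenBy_of_memLp {p : ℝ≥0∞} [hp : Fact (1 ≤ p)] {g : Plane → F} (hg : MemLp g p volume) :
    IsGivenBy (Lp.toTemperedDistribution (hg.toLp g)) g := by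
  refine ⟨hg.locallyIntegrable hp.out, fun φ => ⟨?_, ?_⟩⟩
  · have := ENNReal.HolderConjugate.inv_one_sub_inv' hp.out
    have h := hg.smul (r := 1) (φ.memLp (1 - p⁻¹)⁻¹ volume)
    exact memLp_one_iff_integrable.mp h
  · rw [Lp.toTemperedDistribution_apply]
    refine integral_congr_ae ?_
    filter_upwards [hg.coeFn_toLp] with x hx
    rw [hx]

theorem IsGivenBy.eq_toTemperedDistribution {p : ℝ≥0∞} [hp : Fact (1 ≤ p)] {u : 𝓢'(Plane, F)}
    {g : Plane → F} (hu : IsGivenBy u g) (hg : MemLp g p volume) :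
    u = Lp.toTemperedDistribution (hg.toLp g) := by
  ext φ
  rw [(hu.2 φ).2, ((isGivenBy_of_memLp hg).2 φ).2]

theorem isGivenBy_toTemperedDistribution {p : ℝ≥0∞} [hp : Fact (1 ≤ p)]
    (G : Lp F p (volume : Measure Plane)) :
    IsGivenBy (Lp.toTemperedDistribution G) (G : Plane → F) := by
  have := isGivenBy_of_memLp (Lp.memLp G)
  rwa [Lp.toLp_coeFn] at this

/-- The infimum in `lpNorm` is attained: an `L^p` class is determined by its distribution, so all
representatives of finite norm agree almost everywhere. -/
theorem lpNorm_toTemperedDistribution {p : ℝ≥0∞} [hp : Fact (1 ≤ p)] (G : Lp F p (volume : Measure Plane)) :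
    lpNorm p (Lp.toTemperedDistribution G) = ‖G‖ₑ := by
  rw [Lp.enorm_def]
  refine le_antisymm (iInf₂_le _ (isGivenBy_toTemperedDistribution G)) (le_iInf₂ fun g hg => ?_)
  by_cases hfin : eLpNorm g p volume = ∞
  · simp [hfin]
  have hgp : MemLp g p volume := ⟨hg.aestronglyMeasurable, lt_top_iff_ne_top.mpr hfin⟩
  have hinj := LinearMap.ker_eq_bot.mp
    (Lp.ker_toTemperedDistributionCLM_eq_bot (F := F) (μ := (volume : Measure Plane)) (p := p))
  have : G = hgp.toLp g := hinj (hg.eq_toTemperedDistribution hgp)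
  rw [this, eLpNorm_congr_ae hgp.coeFn_toLp]

theorem exists_lp_of_lpNorm_ne_top {p : ℝ≥0∞} [hp : Fact (1 ≤ p)] {u : 𝓢'(Plane, F)}
    (h : lpNorm p u ≠ ∞) : ∃ G : Lp F p (volume : Measure Plane), u = Lp.toTemperedDistribution G := by
  obtain ⟨g, hg⟩ := iInf_lt_iff.mp (lt_top_iff_ne_top.mpr h)
  obtain ⟨hu, hg⟩ := iInf_lt_iff.mp hg
  exact ⟨_, hu.eq_toTemperedDistribution ⟨hu.aestronglyMeasurable, hg⟩⟩

/-- The triangle inequality for a weakly convergent series of tempered distributions. If the norms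
are summable, the series converges in `L^p`, and its `L^p` sum is the weak limit. -/
theorem lpNorm_le_tsum {p : ℝ≥0∞} [hp : Fact (1 ≤ p)] {u : 𝓢'(Plane, F)} {v : ℕ → 𝓢'(Plane, F)}
    (h : ∀ φ, Tendsto (fun N => ∑ j ∈ Finset.range N, v j φ) atTop (𝓝 (u φ))) :
    lpNorm p u ≤ ∑' j, lpNorm p (v j) := by
  by_cases hfin : ∑' j, lpNorm p (v j) = ∞
  · simp [hfin]
  choose G hG using fun j => exists_lp_of_lpNorm_ne_top (ENNReal.ne_top_of_tsum_ne_top hfin j)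
  have hn : ∀ j, lpNorm p (v j) = ‖G j‖ₑ := fun j => by
    rw [hG, lpNorm_toTemperedDistribution]
  simp only [hn] at hfin ⊢
  have hs : Summable G := by
    refine Summable.of_norm ?_
    exact tsum_enorm_ne_top_iff_summable_norm.mp hfin
  have hu : u = Lp.toTemperedDistribution (∑' j, G j) := by
    ext φ
    refine tendsto_nhds_unique (h φ) ?_
    have h1 := hs.hasSum.tendsto_sum_nat
    have h2 := ((Lp.toTemperedDistributionCLM F (volume : Measure Plane) p).continuous.tendsto _).comp h1
    have h3 := ((PointwiseConvergenceCLM.evalCLM (RingHom.id ℂ) F φ).continuous.tendsto _).comp h2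
    refine h3.congr fun N => ?_
    simp only [comp_apply, map_sum, hG]
    rfl
  rw [hu, lpNorm_toTemperedDistribution]
  exact enorm_tsum_le_tsum_enorm

end

/-! ### Fourier multipliers with Schwartz symbol act by convolution -/

section

variable {F : Type*} [NormedAddCommGroup F] [NormedSpace ℂ F]

/-- Interpolation of `L^p` between `L^1` and `L^∞`. For `p = ∞` the exponent `p⁻¹.toReal` is `0`. -/
theorem eLpNorm_le_of_norm_le_of_integral_le {E : Type*} [NormedAddCommGroup E]
    {v : Plane → E} (hv : Integrable v) {a b : ℝ}
    (ha : 0 ≤ a) (hva : ∀ x, ‖v x‖ ≤ a) (hvb : ∫ x, ‖v x‖ ≤ b) {p : ℝ≥0∞} (hp : 1 ≤ p) :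
    eLpNorm v p volume ≤ ENNReal.ofReal (a ^ (1 - p⁻¹.toReal) * b ^ p⁻¹.toReal) := by
  have hb : 0 ≤ b := (integral_nonneg fun x => norm_nonneg _).trans hvb
  by_cases hpt : p = ∞
  · subst hpt
    simpa using eLpNormEssSup_le_of_ae_bound (.of_forall hva)
  have hp0 : p ≠ 0 := (zero_lt_one.trans_le hp).ne'
  set r := p.toReal with hr
  have hr1 : 1 ≤ r := by simpa using ENNReal.toReal_mono hpt hp
  have hr0 : 0 < r := by linarith
  rw [eLpNorm_eq_lintegral_rpow_enorm_toReal hp0 hpt, ENNReal.toReal_inv, ← hr]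
  have h1 : ∫⁻ x, ‖v x‖ₑ ^ r ≤ ENNReal.ofReal (a ^ (r - 1) * b) := by
    calc ∫⁻ x, ‖v x‖ₑ ^ r ≤ ∫⁻ x, ENNReal.ofReal (a ^ (r - 1)) * ‖v x‖ₑ := by
          refine lintegral_mono fun x => ?_
          rw [← ofReal_norm, ENNReal.ofReal_rpow_of_nonneg (norm_nonneg _) hr0.le,
            ← ENNReal.ofReal_mul (by positivity)]
          refine ENNReal.ofReal_le_ofReal ?_
          calc ‖v x‖ ^ r = ‖v x‖ ^ (r - 1) * ‖v x‖ := by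
                rw [← Real.rpow_add_one' (norm_nonneg _) (by linarith), sub_add_cancel]
            _ ≤ _ := by gcongr; exact hva x
      _ = ENNReal.ofReal (a ^ (r - 1)) * ENNReal.ofReal (∫ x, ‖v x‖) := by
          rw [lintegral_const_mul' _ _ ENNReal.ofReal_ne_top, ofReal_integral_norm_eq_lintegral_enorm hv]
      _ ≤ _ := by
          rw [← ENNReal.ofReal_mul (by positivity)]
          gcongr
  calc (∫⁻ x, ‖v x‖ₑ ^ r) ^ (1 / r) ≤ (ENNReal.ofReal (a ^ (r - 1) * b)) ^ (1 / r) := by gcongr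
    _ = _ := by
      rw [ENNReal.ofReal_rpow_of_nonneg (by positivity) (by positivity),
        Real.mul_rpow (by positivity) hb, ← Real.rpow_mul ha]
      congr 3
      · field_simp
      · simp

theorem norm_convolution_le (k : 𝓢(Plane, ℂ)) {g : Plane → F} (hg : Integrable g) {M : ℝ}
    (hM : ∀ x, ‖k x‖ ≤ M) (z : Plane) :
    ‖(k ⋆[ContinuousLinearMap.lsmul ℂ ℂ, volume] g) z‖ ≤ M * ∫ x, ‖g x‖ := by
  rw [convolution_lsmul_swap, ← integral_const_mul]
  refine norm_integral_le_of_norm_le (hg.norm.const_mul M) (.of_forall fun t => ?_)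
  rw [norm_smul]
  gcongr
  exact hM _

theorem integral_norm_convolution_le (k : 𝓢(Plane, ℂ)) {g : Plane → F} (hg : Integrable g) :
    ∫ z, ‖(k ⋆[ContinuousLinearMap.lsmul ℂ ℂ, volume] g) z‖ ≤ (∫ x, ‖k x‖) * ∫ x, ‖g x‖ := by
  have h := integral_convolution (μ := (volume : Measure Plane)) (ν := volume)
    (ContinuousLinearMap.lsmul ℝ ℝ) k.integrable.norm hg.norm
  simp only [ContinuousLinearMap.lsmul_apply, smul_eq_mul] at h
  rw [← h]
  refine integral_mono_of_nonneg (.of_forall fun z => norm_nonneg _)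
    (k.integrable.norm.integrable_convolution _ hg.norm) (.of_forall fun z => ?_)
  simp only [convolution_lsmul]
  refine (norm_integral_le_integral_norm _).trans (le_of_eq ?_)
  simp [norm_smul]

/-- The Fourier multiplier with symbol `n`, transposed, is convolution with the reflected kernel. -/
theorem fourier_smulLeft_fourierInv (n φ : 𝓢(Plane, ℂ)) (x : Plane) :
    𝓕 (SchwartzMap.smulLeftCLM ℂ n (𝓕⁻ φ)) x = ∫ z, (𝓕⁻ n) (z - x) * φ z := by
  have h1 : 𝓕⁻ (SchwartzMap.convolution (ContinuousLinearMap.lsmul ℂ ℂ) (𝓕 n) φ)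
      = SchwartzMap.smulLeftCLM ℂ n (𝓕⁻ φ) := by
    ext y
    rw [SchwartzMap.smulLeftCLM_apply_apply n.hasTemperateGrowth, SchwartzMap.fourierInv_apply_eq,
      SchwartzMap.fourierInv_apply_eq]
    simp only [SchwartzMap.compCLMOfContinuousLinearEquiv_apply, comp_apply,
      SchwartzMap.fourier_convolution, SchwartzMap.pairing_apply_apply]
    have h2 : (𝓕⁻ (𝓕 n)) y = n y := by rw [FourierTransform.fourierInv_fourier_eq]
    rw [SchwartzMap.fourierInv_apply_eq] at h2
    rw [← h2]
    simp
  rw [← h1, FourierTransform.fourier_fourierInv_eq, SchwartzMap.convolution_apply, convolution_lsmul_swap]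
  refine integral_congr_ae (.of_forall fun z => ?_)
  simp only [smul_eq_mul]
  rw [SchwartzMap.fourierInv_apply_eq]
  simp

variable [CompleteSpace F]

/-- On an integrable function, the Fourier multiplier with Schwartz symbol `n` is convolution with
`𝓕⁻ n`. -/
theorem isGivenBy_fourierMultiplier (n : 𝓢(Plane, ℂ)) {u : 𝓢'(Plane, F)} {g : Plane → F}
    (hu : IsGivenBy u g) (hg : Integrable g) :
    IsGivenBy (TemperedDistribution.fourierMultiplierCLM F n u)
      ((𝓕⁻ n : 𝓢(Plane, ℂ)) ⋆[ContinuousLinearMap.lsmul ℂ ℂ, volume] g) := by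
  set k : 𝓢(Plane, ℂ) := 𝓕⁻ n with hk
  have hvi := k.integrable.integrable_convolution (μ := volume) (ContinuousLinearMap.lsmul ℂ ℂ) hg
  refine ⟨hvi.locallyIntegrable, fun φ => ⟨?_, ?_⟩⟩
  · refine hvi.bdd_smul (SchwartzMap.seminorm ℝ 0 0 φ) φ.continuous.aestronglyMeasurable
      (.of_forall fun x => φ.norm_le_seminorm ℝ x)
  · have hint : Integrable (fun q : Plane × Plane => (k (q.2 - q.1) * φ q.2) • g q.1)
        (volume.prod volume) := by
      have h1 : Integrable (fun q : Plane × Plane => φ q.2 • g q.1) (volume.prod volume) := by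
        exact (φ.integrable.smul_prod hg).swap
      have h2 := h1.bdd_smul (φ := fun q : Plane × Plane => k (q.2 - q.1)) (SchwartzMap.seminorm ℝ 0 0 k)
        (k.continuous.comp (by fun_prop)).aestronglyMeasurable (.of_forall fun x => k.norm_le_seminorm ℝ _)
      simp only [mul_smul]
      exact h2
    rw [TemperedDistribution.fourierMultiplierCLM_apply_apply, (hu.2 _).2]
    simp only [fourier_smulLeft_fourierInv, ← integral_smul_const, ← hk]
    rw [integral_integral_swap hint]
    refine integral_congr_ae (.of_forall fun z => ?_)
    simp only [convolution_lsmul_swap, ← integral_smul, smul_smul, mul_comm]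

theorem fourierInv_dilation {h n : 𝓢(Plane, ℂ)} {l : ℝ} (hl : 0 < l) (hn : ∀ ξ, n ξ = h (l • ξ))
    (x : Plane) : (𝓕⁻ n) x = ((l ^ 2)⁻¹ : ℝ) • (𝓕⁻ h) (l⁻¹ • x) := by
  rw [SchwartzMap.fourierInv_coe, SchwartzMap.fourierInv_coe, Real.fourierInv_eq', Real.fourierInv_eq']
  have := Measure.integral_comp_smul (volume : Measure Plane)
    (fun ξ => Complex.exp (↑(2 * Real.pi * inner ℝ ξ (l⁻¹ • x)) * Complex.I) • h ξ) l
  rw [finrank_euclideanSpace_fin, abs_of_pos (by positivity)] at this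
  rw [← this]
  refine integral_congr_ae (.of_forall fun ξ => ?_)
  simp only [hn, real_inner_smul_left, real_inner_smul_right]
  rw [inv_mul_cancel_left₀ hl.ne']

/-- The `L^1 → L^p` bound for the multiplier with the dilated symbol `h (l ·)`. The kernel of the
dilated symbol has the same `L^1` norm as `𝓕⁻ h`, and its `L^∞` norm carries a factor `l⁻²`. -/
theorem lpNorm_fourierMultiplier_le {h n : 𝓢(Plane, ℂ)} {l M : ℝ} (hl : 0 < l)
    (hn : ∀ ξ, n ξ = h (l • ξ)) (hM : ∀ x, ‖(𝓕⁻ h) x‖ ≤ M) (hM' : ∫ x, ‖(𝓕⁻ h) x‖ ≤ M)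
    {p : ℝ≥0∞} (hp : 1 ≤ p) (u : 𝓢'(Plane, F)) (hu : lpNorm 1 u ≠ ∞) :
    lpNorm p (TemperedDistribution.fourierMultiplierCLM F n u) ≤
      ENNReal.ofReal (M * ((l ^ 2)⁻¹) ^ (1 - p⁻¹.toReal)) * lpNorm 1 u := by
  obtain ⟨G, rfl⟩ := exists_lp_of_lpNorm_ne_top hu
  rw [lpNorm_toTemperedDistribution]
  have hG : Integrable G := memLp_one_iff_integrable.mp (Lp.memLp G)
  set k : 𝓢(Plane, ℂ) := 𝓕⁻ n with hk
  have hM0 : 0 ≤ M := (norm_nonneg _).trans (hM 0)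
  have hk1 : ∀ x, ‖k x‖ ≤ (l ^ 2)⁻¹ * M := fun x => by
    rw [hk, fourierInv_dilation hl hn, norm_smul, Real.norm_of_nonneg (by positivity)]
    gcongr
    exact hM _
  have hk2 : ∫ x, ‖k x‖ ≤ M := by
    refine le_trans (le_of_eq ?_) hM'
    simp only [hk, fourierInv_dilation hl hn, norm_smul]
    rw [integral_const_mul,
      Measure.integral_comp_inv_smul volume (fun a => ‖(𝓕⁻ h : 𝓢(Plane, ℂ)) a‖), finrank_euclideanSpace_fin,
      Real.norm_of_nonneg (by positivity), abs_of_pos (by positivity), smul_eq_mul,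
      inv_mul_cancel_left₀ (by positivity)]
  have hGn : ENNReal.ofReal (∫ x, ‖G x‖) = ‖G‖ₑ := by
    rw [Lp.enorm_def, eLpNorm_one_eq_lintegral_enorm, ofReal_integral_norm_eq_lintegral_enorm hG]
  have hI : 0 ≤ ∫ x, ‖G x‖ := integral_nonneg fun _ => norm_nonneg _
  refine (iInf₂_le _ (isGivenBy_fourierMultiplier n (isGivenBy_toTemperedDistribution G) hG)).trans ?_
  refine (eLpNorm_le_of_norm_le_of_integral_le
    (k.integrable.integrable_convolution (ContinuousLinearMap.lsmul ℂ ℂ) hG) (by positivity)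
    (norm_convolution_le k hG hk1)
    ((integral_norm_convolution_le k hG).trans (mul_le_mul_of_nonneg_right hk2 hI)) hp).trans ?_
  rw [← hGn, ← ENNReal.ofReal_mul (by positivity)]
  refine ENNReal.ofReal_le_ofReal (le_of_eq ?_)
  set θ := p⁻¹.toReal
  rw [mul_assoc, Real.mul_rpow (by positivity) (by positivity)]
  have : (M * ∫ x, ‖G x‖) ^ (1 - θ) * (M * ∫ x, ‖G x‖) ^ θ = M * ∫ x, ‖G x‖ := by
    rw [← Real.rpow_add' (by positivity) (by norm_num), sub_add_cancel, Real.rpow_one]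
  rw [mul_assoc, this]
  ring

end

/-! ### Littlewood–Paley decomposition -/

section

variable {F : Type*} [NormedAddCommGroup F] [NormedSpace ℂ F]

/-- A function equal to `1` near the origin: since the derivatives of `1 - χ` vanish there and are
bounded, they are `O(‖y‖)` globally. The factor `‖y‖` becomes a gain under dilation. -/
theorem exists_norm_iteratedFDeriv_one_sub_le {χ : 𝓢(Plane, ℂ)} {r : ℝ} (hr : 0 < r)
    (hχ : ∀ ξ, ‖ξ‖ < r → χ ξ = 1) (i : ℕ) :
    ∃ M : ℝ, 0 ≤ M ∧ ∀ y, ‖iteratedFDeriv ℝ i (fun ξ => 1 - χ ξ) y‖ ≤ M * ‖y‖ := by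
  set C : ℝ := 1 + SchwartzMap.seminorm ℝ 0 i χ with hC
  have hC0 : 0 ≤ C := add_nonneg zero_le_one (apply_nonneg _ _)
  refine ⟨C / r, by positivity, fun y => ?_⟩
  rcases lt_or_ge ‖y‖ r with h | h
  · have h0 : (fun ξ => 1 - χ ξ) =ᶠ[𝓝 y] fun _ => 0 := by
      filter_upwards [(isOpen_lt continuous_norm continuous_const).mem_nhds h] with x hx
      rw [hχ x hx, sub_self]
    rw [(h0.iteratedFDeriv ℝ i).eq_of_nhds]
    simp only [iteratedFDeriv_fun_zero, Pi.zero_apply, norm_zero]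
    positivity
  · calc ‖iteratedFDeriv ℝ i (fun ξ => 1 - χ ξ) y‖ ≤ C := by
          rw [fun_iteratedFDeriv_sub_apply contDiffAt_const (χ.contDiffAt i)]
          refine (norm_sub_le _ _).trans (add_le_add ?_ (χ.norm_iteratedFDeriv_le_seminorm ℝ i y))
          cases i with
          | zero => simp
          | succ i => simp [iteratedFDeriv_const_of_ne (Nat.succ_ne_zero i)]
      _ ≤ C / r * ‖y‖ := by
          rw [div_mul_eq_mul_div, le_div_iff₀ hr]
          gcongr

theorem hasTemperateGrowth_dilation (χ : 𝓢(Plane, ℂ)) (t : ℝ) :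
    (fun ξ => χ (t • ξ)).HasTemperateGrowth :=
  χ.hasTemperateGrowth.comp (t • ContinuousLinearMap.id ℝ Plane).hasTemperateGrowth

/-- Multiplication by `χ (t ·)` differs from the identity by `O(t)` in every Schwartz seminorm. -/
theorem seminorm_smulLeft_dilation_sub_le {χ : 𝓢(Plane, ℂ)} {r : ℝ} (hr : 0 < r)
    (hχ : ∀ ξ, ‖ξ‖ < r → χ ξ = 1) (ψ : 𝓢(Plane, ℂ)) (k n : ℕ) :
    ∃ C : ℝ, ∀ t : ℝ, 0 ≤ t → t ≤ 1 →
      SchwartzMap.seminorm ℂ k n (SchwartzMap.smulLeftCLM ℂ (fun ξ => χ (t • ξ)) ψ - ψ) ≤ C * t := by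
  choose M hM0 hM using exists_norm_iteratedFDeriv_one_sub_le hr hχ
  refine ⟨∑ i ∈ Finset.range (n + 1), (n.choose i : ℝ) * (M i) * SchwartzMap.seminorm ℝ (k + 1) (n - i) ψ,
    fun t ht ht1 => ?_⟩
  refine SchwartzMap.seminorm_le_bound ℂ k n _ ?_ fun x => ?_
  · refine mul_nonneg (Finset.sum_nonneg fun i _ => ?_) ht
    have := hM0 i
    positivity
  have hw : ContDiff ℝ (⊤ : ℕ∞) (fun ξ => 1 - χ ξ) := contDiff_const.sub (χ.smooth ⊤)
  have hw' : ContDiff ℝ (⊤ : ℕ∞) (fun ξ => 1 - χ (t • ξ)) := hw.comp (contDiff_const_smul t)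
  have e : ⇑(SchwartzMap.smulLeftCLM ℂ (fun ξ => χ (t • ξ)) ψ - ψ)
      = - fun ξ => (1 - χ (t • ξ)) * ψ ξ := by
    ext ξ
    rw [sub_apply, SchwartzMap.smulLeftCLM_apply_apply (hasTemperateGrowth_dilation χ t)]
    simp only [smul_eq_mul, Pi.neg_apply]
    ring
  rw [e, iteratedFDeriv_neg, Pi.neg_apply, norm_neg]
  have h1 := norm_iteratedFDeriv_mul_le (𝕜 := ℝ) (n := n) (N := (⊤ : ℕ∞)) hw' (ψ.smooth ⊤) x
    (by exact_mod_cast le_top)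
  calc ‖x‖ ^ k * _ ≤ ‖x‖ ^ k * _ := by gcongr
    _ = ∑ i ∈ Finset.range (n + 1), ‖x‖ ^ k * _ := Finset.mul_sum _ _ _
    _ ≤ ∑ i ∈ Finset.range (n + 1),
        (n.choose i : ℝ) * (M i) * SchwartzMap.seminorm ℝ (k + 1) (n - i) ψ * t := by
      refine Finset.sum_le_sum fun i _ => ?_
      have h2 : ‖iteratedFDeriv ℝ i (fun ξ => 1 - χ (t • ξ)) x‖ ≤ M i * (t * ‖x‖) := by
        rw [iteratedFDeriv_comp_const_smul (f := fun ξ => 1 - χ ξ) t (hw.of_le (by exact_mod_cast le_top)),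
          norm_smul, norm_pow, Real.norm_of_nonneg ht]
        have h3 := hM i (t • x)
        rw [norm_smul, Real.norm_of_nonneg ht] at h3
        exact (mul_le_of_le_one_left (norm_nonneg _) (pow_le_one₀ ht ht1)).trans h3
      have h4 := ψ.le_seminorm ℝ (k + 1) (n - i) x
      calc _ ≤ ‖x‖ ^ k * ((n.choose i : ℝ) * (M i * (t * ‖x‖)) * ‖iteratedFDeriv ℝ (n - i) ψ x‖) := by
            gcongr
        _ = (n.choose i : ℝ) * (M i) * (‖x‖ ^ (k + 1) * ‖iteratedFDeriv ℝ (n - i) ψ x‖) * t := by ring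
        _ ≤ _ := by
            have := hM0 i
            gcongr
    _ = _ := (Finset.sum_mul _ _ _).symm

theorem tendsto_smulLeft_dilation {χ : 𝓢(Plane, ℂ)} {r : ℝ} (hr : 0 < r)
    (hχ : ∀ ξ, ‖ξ‖ < r → χ ξ = 1) (ψ : 𝓢(Plane, ℂ)) :
    Tendsto (fun N : ℕ => SchwartzMap.smulLeftCLM ℂ (fun ξ => χ ((2⁻¹ : ℝ) ^ N • ξ)) ψ)
      atTop (𝓝 ψ) := by
  rw [(schwartz_withSeminorms ℂ Plane ℂ).tendsto_nhds]
  rintro ⟨k, n⟩ ε hε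
  obtain ⟨C, hC⟩ := seminorm_smulLeft_dilation_sub_le hr hχ ψ k n
  have ht : Tendsto (fun N : ℕ => C * (2⁻¹ : ℝ) ^ N) atTop (𝓝 0) := by
    simpa using (tendsto_pow_atTop_nhds_zero_of_lt_one (r := (2⁻¹ : ℝ)) (by norm_num)
      (by norm_num)).const_mul C
  filter_upwards [ht.eventually_lt_const hε] with N hN
  exact (hC _ (by positivity) (pow_le_one₀ (by norm_num) (by norm_num))).trans_lt hN

namespace DyadicCutoff

variable (ρ : DyadicCutoff)

/-- The symbol of the `j`-th Littlewood–Paley piece: the low-frequency cutoff for `j = 0`, and the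
annular cutoff at frequency `2 ^ j` for `j ≥ 1`. -/
noncomputable def block : ℕ → Plane → ℝ
  | 0 => ρ.low
  | j + 1 => ρ.annulus (j + 1)

theorem block_hasTemperateGrowth (j : ℕ) : (ρ.block j).HasTemperateGrowth := by
  cases j with
  | zero => exact ρ.low_hasTemperateGrowth
  | succ j => exact ρ.annulus_hasTemperateGrowth _

theorem low_eq_add_low (ξ : Plane) : ρ.low ξ = ρ.toSchwartz ξ + ρ.low ((2 : ℝ) • ξ) := by
  by_cases h0 : ξ = 0
  · subst h0
    rw [smul_zero, ρ.eq_zero_of_le 0 (by norm_num), zero_add]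
  have hs : Summable fun k : ℕ => ρ.toSchwartz ((2 : ℝ) ^ k • ξ) := by
    have inj : Function.Injective (fun k : ℕ => -(k : ℤ)) := fun a b h => by simpa using h
    simpa [Function.comp_def] using (ρ.hasSum_one ξ h0).summable.comp_injective inj
  unfold low
  rw [if_neg h0, if_neg (by simpa using h0), hs.tsum_eq_zero_add]
  simp [pow_succ, smul_smul]

/-- The Littlewood–Paley symbols telescope: their partial sums are dilates of the low-frequency
cutoff. -/
theorem sum_block (N : ℕ) (ξ : Plane) :
    ∑ j ∈ Finset.range (N + 1), ρ.block j ξ = ρ.low ((2⁻¹ : ℝ) ^ N • ξ) := by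
  induction N with
  | zero => simp [block]
  | succ N ih =>
    rw [Finset.sum_range_succ, ih, ρ.low_eq_add_low ((2⁻¹ : ℝ) ^ (N + 1) • ξ), smul_smul, add_comm]
    congr 2
    · show ρ.toSchwartz ((2 : ℝ) ^ (-((N + 1 : ℕ) : ℤ)) • ξ) = _
      rw [zpow_neg, zpow_natCast, inv_pow]
    · rw [pow_succ]
      congr 1
      ring

theorem low_hasCompactSupport : HasCompactSupport ρ.low := by
  refine HasCompactSupport.intro (isCompact_closedBall (0 : Plane) (15 / 7)) fun ξ h => ?_
  have h : 15 / 7 < ‖ξ‖ := by simpa using h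
  rw [ρ.low_eq ξ (by linarith)]
  exact ρ.eq_zero_of_ge _ (by linarith)

theorem toSchwartz_hasCompactSupport :
    HasCompactSupport ρ.toSchwartz := by
  refine HasCompactSupport.intro (isCompact_closedBall (0 : Plane) (15 / 7)) fun ξ h => ?_
  have h : 15 / 7 < ‖ξ‖ := by simpa using h
  exact ρ.eq_zero_of_ge _ (by linarith)

end DyadicCutoff

theorem exists_dilation (h : 𝓢(Plane, ℂ)) {l : ℝ} (hl : l ≠ 0) :
    ∃ n : 𝓢(Plane, ℂ), ∀ ξ, n ξ = h (l • ξ) :=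
  ⟨SchwartzMap.compCLMOfContinuousLinearEquiv ℂ
    (ContinuousLinearEquiv.smulLeft (Units.mk0 l hl) : Plane ≃L[ℝ] Plane) h, fun _ => rfl⟩

theorem exists_schwartz_of_hasCompactSupport {m : Plane → ℝ} (hm : m.HasTemperateGrowth)
    (hc : HasCompactSupport m) : ∃ n : 𝓢(Plane, ℂ), ∀ ξ, n ξ = (m ξ : ℂ) :=
  ⟨(hc.comp_left (g := fun x : ℝ => (x : ℂ)) Complex.ofReal_zero).toSchwartzMap
    (Complex.ofRealCLM.contDiff.comp hm.1), fun _ => rfl⟩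

/-- The Littlewood–Paley pieces of a tempered distribution sum to it weakly. -/
theorem tendsto_sum_block (ρ : DyadicCutoff) (u : 𝓢'(Plane, F)) (φ : 𝓢(Plane, ℂ)) :
    Tendsto (fun N => ∑ j ∈ Finset.range N, multiplier (ρ.block j) u φ) atTop (𝓝 (u φ)) := by
  obtain ⟨χ₀, hχ₀⟩ := exists_schwartz_of_hasCompactSupport ρ.low_hasTemperateGrowth
    ρ.low_hasCompactSupport
  obtain ⟨χ, hχ'⟩ := exists_dilation χ₀ (l := 2 * Real.pi) (by positivity)
  have hχ : ∀ ξ, χ ξ = (ρ.low ((2 * Real.pi) • ξ) : ℂ) := fun ξ => by rw [hχ', hχ₀]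
  have hχ1 : ∀ ξ, ‖ξ‖ < 1 / (2 * Real.pi) → χ ξ = 1 := fun ξ h => by
    rw [hχ, ρ.low_one, Complex.ofReal_one]
    rw [lt_div_iff₀ (by positivity)] at h
    rw [norm_smul, Real.norm_of_nonneg (by positivity)]
    linarith
  have h1 := tendsto_smulLeft_dilation (by positivity) hχ1 (𝓕⁻ φ)
  have h2 := ((u.continuous.comp (fourierCLM ℂ 𝓢(Plane, ℂ)).continuous).tendsto _).comp h1
  rw [← tendsto_add_atTop_iff_nat 1]
  have h3 : u (𝓕 (𝓕⁻ φ : 𝓢(Plane, ℂ))) = u φ := by rw [FourierTransform.fourier_fourierInv_eq]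
  rw [← h3]
  refine h2.congr fun N => ?_
  have h4 : (fun ξ => χ ((2⁻¹ : ℝ) ^ N • ξ))
      = fun ξ => ∑ j ∈ Finset.range (N + 1), ((ρ.block j ((2 * Real.pi) • ξ) : ℝ) : ℂ) := by
    ext ξ
    rw [hχ, smul_comm, ← ρ.sum_block, Complex.ofReal_sum]
  rw [comp_apply, h4, SchwartzMap.smulLeftCLM_sum
    (fun j _ => hasTemperateGrowth_scale (ρ.block_hasTemperateGrowth j))]
  simp only [multiplier, TemperedDistribution.fourierMultiplierCLM_apply_apply, sum_apply,
    comp_apply, map_sum (fourierCLM ℂ 𝓢(Plane, ℂ))]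
  exact map_sum u.toLinearMap _ _

end

/-! ### Rescaled dyadic pieces of the symbol -/

/-- On a bounded subset of the Schwartz space, the inverse Fourier transform is bounded in `L^∞`
and in `L^1`, being continuous into both. -/
theorem exists_norm_fourierInv_le {S : Set 𝓢(Plane, ℂ)}
    (hS : ∀ k n : ℕ, ∃ C : ℝ, ∀ h ∈ S, SchwartzMap.seminorm ℂ k n h ≤ C) :
    ∃ M : ℝ, ∀ h ∈ S, (∀ x, ‖(𝓕⁻ h : 𝓢(Plane, ℂ)) x‖ ≤ M) ∧ ∫ x, ‖(𝓕⁻ h : 𝓢(Plane, ℂ)) x‖ ≤ M := by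
  have hb : Bornology.IsVonNBounded ℂ S := by
    rw [(schwartz_withSeminorms ℂ Plane ℂ).isVonNBounded_iff_seminorm_bounded]
    rintro ⟨k, n⟩
    obtain ⟨C, hC⟩ := hS k n
    exact ⟨max C 0 + 1, by positivity, fun h hh =>
      ((hC h hh).trans (le_max_left _ _)).trans_lt (lt_add_one _)⟩
  have h1 := hb.image (SchwartzMap.toLpCLM ℂ ℂ 1 (volume : Measure Plane) ∘L
    fourierInvCLM ℂ 𝓢(Plane, ℂ))
  have h2 := hb.image (SchwartzMap.toBoundedContinuousFunctionCLM ℂ Plane ℂ ∘L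
    fourierInvCLM ℂ 𝓢(Plane, ℂ))
  rw [NormedSpace.image_isVonNBounded_iff] at h1 h2
  obtain ⟨M1, hM1⟩ := h1
  obtain ⟨M2, hM2⟩ := h2
  refine ⟨max M1 M2, fun h hh => ⟨fun x => ?_, ?_⟩⟩
  · refine le_trans ?_ ((hM2 h hh).trans (le_max_right _ _))
    exact BoundedContinuousFunction.norm_coe_le_norm
      (SchwartzMap.toBoundedContinuousFunctionCLM ℂ Plane ℂ (𝓕⁻ h)) x
  · refine le_trans ?_ ((hM1 h hh).trans (le_max_left _ _))
    exact SchwartzMap.norm_toLp_one.ge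

/-- The slices `H (t, ·)`, `0 ≤ t ≤ 1`, of a jointly smooth function with spatially bounded
support form a bounded set in the Schwartz space. -/
theorem exists_bound_iteratedFDeriv_slice {H : ℝ × Plane → ℂ} (hH : ContDiff ℝ (⊤ : ℕ∞) H) {R : ℝ}
    (hR : ∀ t ξ, R ≤ ‖ξ‖ → H (t, ξ) = 0) (k n : ℕ) :
    ∃ C : ℝ, ∀ t ∈ Set.Icc (0 : ℝ) 1, ∀ ξ,
      ‖ξ‖ ^ k * ‖iteratedFDeriv ℝ n (fun η => H (t, η)) ξ‖ ≤ C := by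
  have hc : Continuous (iteratedFDeriv ℝ n H) := hH.continuous_iteratedFDeriv (by exact_mod_cast le_top)
  obtain ⟨C, hC⟩ := (isCompact_Icc.prod (isCompact_closedBall (0 : Plane) R)).exists_bound_of_continuousOn
    (s := Set.Icc (0 : ℝ) 1 ×ˢ Metric.closedBall (0 : Plane) R) hc.continuousOn
  refine ⟨max 0 (R ^ k * C), fun t ht ξ => ?_⟩
  rcases lt_or_ge R ‖ξ‖ with h | h
  · have h0 : (fun η => H (t, η)) =ᶠ[𝓝 ξ] fun _ => 0 := by
      filter_upwards [(isOpen_lt continuous_const continuous_norm).mem_nhds h] with x hx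
      exact hR t x (le_of_lt hx)
    rw [(h0.iteratedFDeriv ℝ n).eq_of_nhds]
    simp
  · refine le_trans ?_ (le_max_right _ _)
    have hR0 : 0 ≤ R := (norm_nonneg ξ).trans h
    have h1 : ‖iteratedFDeriv ℝ n (fun η => H (t, η)) ξ‖ ≤ C := by
      have h2 : (fun η => H (t, η)) = (fun p => H ((t, 0) + p)) ∘ ContinuousLinearMap.inr ℝ ℝ Plane := by
        ext η
        simp
      have h3 : ContDiff ℝ (⊤ : ℕ∞) fun p => H ((t, 0) + p) := hH.comp (contDiff_const.add contDiff_id)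
      rw [h2, ContinuousLinearMap.iteratedFDeriv_comp_right _ h3 _ (by exact_mod_cast le_top),
        iteratedFDeriv_comp_add_left]
      refine (ContinuousMultilinearMap.norm_compContinuousLinearMap_le _ _).trans ?_
      have h4 : ‖iteratedFDeriv ℝ n H ((t, 0) + ContinuousLinearMap.inr ℝ ℝ Plane ξ)‖ ≤ C := by
        refine hC _ ⟨?_, ?_⟩
        · simpa using ht
        · simpa using h
      refine (mul_le_of_le_one_right (norm_nonneg _) ?_).trans h4
      exact Finset.prod_le_one (fun _ _ => norm_nonneg _) fun _ _ => ContinuousLinearMap.norm_inr_le_one ℝ ℝ Plane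
    gcongr

/-- The symbol `(b + |ξ|²)⁻¹ (1 + |ξ|²)^{σ/2}` of `(b - Δ)⁻¹ (1 - Δ)^{σ/2}`. -/
noncomputable def symbol (b σ : ℝ) (ξ : Plane) : ℝ := (b + ‖ξ‖ ^ 2)⁻¹ * (1 + ‖ξ‖ ^ 2) ^ (σ / 2)

theorem symbol_hasTemperateGrowth {b : ℝ} (hb : 0 < b) (σ : ℝ) : (symbol b σ).HasTemperateGrowth :=
  (resolvent_symbol_hasTemperateGrowth hb).mul (bessel_symbol_hasTemperateGrowth σ)

/-- A smooth cutoff equal to `1` on the support of the low-frequency cutoff. -/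
noncomputable def discBump : ContDiffBump (0 : Plane) := ⟨15 / 7, 3, by norm_num, by norm_num⟩

/-- A smooth cutoff equal to `1` near the origin that vanishes on the support of a dyadic cutoff. -/
noncomputable def holeBump : ContDiffBump (0 : Plane) := ⟨1 / 2, 6 / 7, by norm_num, by norm_num⟩

/-- The symbol `symbol b σ` at the point `ξ = η / t`, multiplied by `t ^ (σ - 2)` and cut off
smoothly to an annulus `|η| ∼ 1`; the cutoff is `1` on the support of any `DyadicCutoff`. The pair
`p` is `(t, η)`. For `b > 0` the formula is smooth in all real `t`, including `t = 0`. -/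
noncomputable def rescaledSymbol (b σ : ℝ) (p : ℝ × Plane) : ℝ :=
  discBump p.2 * (1 - holeBump p.2) *
    ((b * p.1 ^ 2 + ‖p.2‖ ^ 2)⁻¹ * (p.1 ^ 2 + ‖p.2‖ ^ 2) ^ (σ / 2))

theorem contDiff_rescaledSymbol {b : ℝ} (hb : 0 < b) (σ : ℝ) :
    ContDiff ℝ (⊤ : ℕ∞) (rescaledSymbol b σ) := by
  rw [contDiff_iff_contDiffAt]
  rintro ⟨t, ξ⟩
  rcases lt_or_ge ‖ξ‖ (1 / 2) with h | h
  · refine (contDiffAt_const (c := (0 : ℝ))).congr_of_eventuallyEq ?_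
    have hopen : IsOpen {p : ℝ × Plane | ‖p.2‖ < 1 / 2} := isOpen_lt (by fun_prop) continuous_const
    filter_upwards [hopen.mem_nhds h] with p hp
    have : holeBump p.2 = 1 := holeBump.one_of_mem_closedBall (by simpa [holeBump] using le_of_lt hp)
    simp [rescaledSymbol, this]
  · have h0 : 0 < ‖ξ‖ := by linarith
    have hn : ContDiffAt ℝ (⊤ : ℕ∞) (fun p : ℝ × Plane => ‖p.2‖ ^ 2) (t, ξ) :=
      (contDiff_snd.norm_sq ℝ).contDiffAt
    have ht : ContDiffAt ℝ (⊤ : ℕ∞) (fun p : ℝ × Plane => p.1 ^ 2) (t, ξ) :=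
      (contDiff_fst.pow 2).contDiffAt
    unfold rescaledSymbol
    refine ContDiffAt.mul (ContDiffAt.mul ?_ (contDiffAt_const.sub ?_)) (ContDiffAt.mul ?_ ?_)
    · exact (discBump.contDiff.comp contDiff_snd).contDiffAt
    · exact (holeBump.contDiff.comp contDiff_snd).contDiffAt
    · refine ((contDiffAt_const.mul ht).add hn).inv ?_
      positivity
    · refine (ht.add hn).rpow_const_of_ne ?_
      positivity

theorem rescaledSymbol_eq_zero (b σ t : ℝ) {ξ : Plane} (h : 3 ≤ ‖ξ‖) : rescaledSymbol b σ (t, ξ) = 0 := by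
  have : discBump ξ = 0 := discBump.zero_of_le_dist (by simpa [discBump] using h)
  simp [rescaledSymbol, this]

/-- The kernels of the rescaled symbols are bounded in `L^1` and `L^∞`, uniformly in `t ∈ [0, 1]`. -/
theorem exists_rescaledSymbol_schwartz {b : ℝ} (hb : 0 < b) (σ : ℝ) :
    ∃ (h : ℝ → 𝓢(Plane, ℂ)) (M : ℝ), (∀ t ξ, h t ξ = (rescaledSymbol b σ (t, ξ) : ℂ)) ∧
      ∀ t ∈ Set.Icc (0 : ℝ) 1,
        (∀ x, ‖(𝓕⁻ (h t) : 𝓢(Plane, ℂ)) x‖ ≤ M) ∧ ∫ x, ‖(𝓕⁻ (h t) : 𝓢(Plane, ℂ)) x‖ ≤ M := by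
  have hH : ContDiff ℝ (⊤ : ℕ∞) fun p => (rescaledSymbol b σ p : ℂ) :=
    Complex.ofRealCLM.contDiff.comp (contDiff_rescaledSymbol hb σ)
  have h0 : ∀ (t : ℝ) (ξ : Plane), 3 ≤ ‖ξ‖ → (rescaledSymbol b σ (t, ξ) : ℂ) = 0 := fun t ξ h => by
    rw [rescaledSymbol_eq_zero b σ t h, Complex.ofReal_zero]
  have hc : ∀ t : ℝ, HasCompactSupport fun ξ => (rescaledSymbol b σ (t, ξ) : ℂ) := fun t => by
    refine HasCompactSupport.intro (isCompact_closedBall (0 : Plane) 3) fun ξ h => h0 t ξ ?_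
    simpa using (not_le.mp (by simpa using h)).le
  let h : ℝ → 𝓢(Plane, ℂ) := fun t => (hc t).toSchwartzMap (hH.comp (contDiff_prodMk_right t))
  obtain ⟨M, hM⟩ := exists_norm_fourierInv_le (S := h '' Set.Icc 0 1) fun k n => by
    obtain ⟨C, hC⟩ := exists_bound_iteratedFDeriv_slice hH h0 k n
    refine ⟨max C 0, ?_⟩
    rintro _ ⟨t, ht, rfl⟩
    exact SchwartzMap.seminorm_le_bound ℂ k n _ (le_max_right _ _) fun ξ =>
      (hC t ht ξ).trans (le_max_left _ _)
  exact ⟨h, M, fun t ξ => rfl, fun t ht => hM _ ⟨t, ht, rfl⟩⟩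

/-! ### The logarithmic estimate -/

section

variable {F : Type*} [NormedAddCommGroup F] [NormedSpace ℂ F]

theorem resolvent_bessel {b : ℝ} (hb : 0 < b) (s : ℝ) (f : 𝓢'(Plane, F)) :
    resolvent b (bessel s f) = multiplier (symbol b s) f := by
  unfold resolvent bessel multiplier
  rw [TemperedDistribution.fourierMultiplierCLM_fourierMultiplierCLM_apply
    (hasTemperateGrowth_scale (bessel_symbol_hasTemperateGrowth s))
    (hasTemperateGrowth_scale (resolvent_symbol_hasTemperateGrowth hb))]
  congr 2
  ext ξ
  simp only [Pi.mul_apply, symbol]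
  push_cast
  ring

theorem resolvent_eq_multiplier_symbol (b : ℝ) (f : 𝓢'(Plane, F)) :
    resolvent b f = multiplier (symbol b 0) f := by
  unfold resolvent
  congr 2
  ext ξ
  simp [symbol]

/-- A symbol `m` applied after `a` may be replaced by any Schwartz symbol that agrees with it
where `a` does not vanish. -/
theorem multiplier_multiplier_eq {m a : Plane → ℝ} (hm : m.HasTemperateGrowth)
    (ha : a.HasTemperateGrowth) (n : 𝓢(Plane, ℂ))
    (h : ∀ ξ, (a ((2 * Real.pi) • ξ) : ℂ) * n ξ
      = a ((2 * Real.pi) • ξ) * m ((2 * Real.pi) • ξ)) (f : 𝓢'(Plane, F)) :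
    multiplier m (multiplier a f)
      = TemperedDistribution.fourierMultiplierCLM F n (multiplier a f) := by
  unfold multiplier
  rw [TemperedDistribution.fourierMultiplierCLM_fourierMultiplierCLM_apply
      (hasTemperateGrowth_scale ha) (hasTemperateGrowth_scale hm),
    TemperedDistribution.fourierMultiplierCLM_fourierMultiplierCLM_apply
      (hasTemperateGrowth_scale ha) n.hasTemperateGrowth]
  congr 2
  ext ξ
  exact (h ξ).symm

theorem exists_norm_fourierInv_le_single (h : 𝓢(Plane, ℂ)) :
    ∃ M : ℝ, (∀ x, ‖(𝓕⁻ h : 𝓢(Plane, ℂ)) x‖ ≤ M) ∧ ∫ x, ‖(𝓕⁻ h : 𝓢(Plane, ℂ)) x‖ ≤ M := by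
  obtain ⟨M, hM⟩ := exists_norm_fourierInv_le (S := {h}) fun k n =>
    ⟨SchwartzMap.seminorm ℂ k n h, fun g hg => by rw [Set.mem_singleton_iff.mp hg]⟩
  exact ⟨M, hM h rfl⟩

theorem symbol_eq_rescaledSymbol (b σ : ℝ) {t : ℝ} (ht : 0 < t) {ξ : Plane}
    (h1 : 6 / 7 ≤ ‖t • ξ‖) (h2 : ‖t • ξ‖ ≤ 15 / 7) :
    symbol b σ ξ = (t ^ 2) ^ (1 - σ / 2) * rescaledSymbol b σ (t, t • ξ) := by
  have e1 : discBump (t • ξ) = 1 := discBump.one_of_mem_closedBall (by simpa [discBump] using h2)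
  have e2 : holeBump (t • ξ) = 0 := holeBump.zero_of_le_dist (by simpa [holeBump] using h1)
  have hn : ‖t • ξ‖ ^ 2 = t ^ 2 * ‖ξ‖ ^ 2 := by
    rw [norm_smul, mul_pow, Real.norm_eq_abs, sq_abs]
  simp only [rescaledSymbol, symbol, e1, e2, hn]
  have e3 : b * t ^ 2 + t ^ 2 * ‖ξ‖ ^ 2 = t ^ 2 * (b + ‖ξ‖ ^ 2) := by ring
  have e4 : t ^ 2 + t ^ 2 * ‖ξ‖ ^ 2 = t ^ 2 * (1 + ‖ξ‖ ^ 2) := by ring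
  have ht2 : 0 < t ^ 2 := by positivity
  rw [e3, e4, Real.mul_rpow ht2.le (by positivity), mul_inv, Real.rpow_sub ht2, Real.rpow_one]
  have : (t ^ 2) ^ (σ / 2) ≠ 0 := (Real.rpow_pos_of_pos ht2 _).ne'
  field_simp
  ring

theorem DyadicCutoff.annulus_mul_symbol (ρ : DyadicCutoff) (b σ : ℝ) (j : ℕ) (ξ : Plane) :
    ρ.annulus j ξ * (((2⁻¹ ^ j) ^ 2) ^ (1 - σ / 2) *
      rescaledSymbol b σ (2⁻¹ ^ j, (2⁻¹ ^ j : ℝ) • ξ)) = ρ.annulus j ξ * symbol b σ ξ := by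
  have e : (2 : ℝ) ^ (-(j : ℤ)) = 2⁻¹ ^ j := by rw [zpow_neg, zpow_natCast, inv_pow]
  rcases le_or_gt ‖(2⁻¹ ^ j : ℝ) • ξ‖ (6 / 7) with h1 | h1
  · rw [annulus, e, ρ.eq_zero_of_le _ (by linarith), zero_mul, zero_mul]
  rcases le_or_gt (15 / 7) ‖(2⁻¹ ^ j : ℝ) • ξ‖ with h2 | h2
  · rw [annulus, e, ρ.eq_zero_of_ge _ (by linarith), zero_mul, zero_mul]
  rw [symbol_eq_rescaledSymbol b σ (by positivity) h1.le h2.le]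

theorem DyadicCutoff.low_mul_discBump (ρ : DyadicCutoff) (ξ : Plane) :
    ρ.low ξ * discBump ξ = ρ.low ξ := by
  rcases le_or_gt ‖ξ‖ (15 / 7) with h | h
  · rw [discBump.one_of_mem_closedBall (by simpa [discBump] using h), mul_one]
  · rw [ρ.low_eq ξ (by linarith), ρ.eq_zero_of_ge ξ (by linarith), zero_mul]

/-- The choice of the splitting frequency. If the terms are bounded both by `K x` and by `2^{-js}
y`, the first bound is used for `j < N`, where `N` is minimal with `2^{Ns} ≥ 2 + y / x`, and the
geometric tail from `N` on is `O(x)`. -/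
theorem tsum_le_log {s K : ℝ} (hs : 0 < s) (hK : 0 ≤ K) : ∃ C : ℝ, 0 ≤ C ∧
    ∀ (a : ℕ → ℝ≥0∞) (x y : ℝ), 0 ≤ x → 0 ≤ y → (∀ j, a j ≤ ENNReal.ofReal (K * x)) →
      (∀ j, a j ≤ ENNReal.ofReal (((2 : ℝ) ^ (-s)) ^ j * y)) →
      ∑' j, a j ≤ ENNReal.ofReal (C * x * Real.log (2 + y / x)) := by
  set r : ℝ := (2 : ℝ) ^ (-s) with hr
  have hr0 : 0 < r := by positivity
  have hr1 : r < 1 := Real.rpow_lt_one_of_one_lt_of_neg one_lt_two (by linarith)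
  have hl2 : 0 < Real.log 2 := Real.log_pos one_lt_two
  have hr1' : 0 < 1 - r := by linarith
  refine ⟨K * (1 / (s * Real.log 2) + 1 / Real.log 2) + (1 - r)⁻¹ / Real.log 2, by positivity,
    fun a x y hx hy h1 h2 => ?_⟩
  rcases hx.eq_or_lt with rfl | hx
  · -- here `y / x` is a junk value, but all terms vanish
    have : ∀ j, a j = 0 := fun j => by simpa using h1 j
    simp [this]
  set L := Real.log (2 + y / x) with hL
  have hyx : 0 ≤ y / x := by positivity
  have hL2 : Real.log 2 ≤ L := Real.log_le_log two_pos (by linarith)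
  -- the least `N` with `2 ^ (N s) ≥ exp L = 2 + y / x`
  set N := ⌈L / (s * Real.log 2)⌉₊ with hN
  have hN1 : (N : ℝ) ≤ L / (s * Real.log 2) + 1 :=
    (Nat.ceil_lt_add_one (div_nonneg (hl2.le.trans hL2) (by positivity))).le
  have hN2 : L ≤ N * (s * Real.log 2) := (div_le_iff₀ (by positivity)).mp (Nat.le_ceil _)
  have hrN : r ^ N * y ≤ x := by
    have e1 : r ^ N = Real.exp (-(N * (s * Real.log 2))) := by
      rw [hr, Real.rpow_def_of_pos two_pos, ← Real.exp_nat_mul]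
      ring_nf
    have e2 : Real.exp (-(N * (s * Real.log 2))) ≤ (2 + y / x)⁻¹ := by
      rw [← Real.exp_log (x := 2 + y / x) (by positivity), ← Real.exp_neg]
      exact Real.exp_le_exp.mpr (by linarith)
    rw [e1]
    calc _ ≤ (2 + y / x)⁻¹ * y := by gcongr
      _ ≤ x := by
        rw [inv_mul_le_iff₀ (by positivity), add_mul, div_mul_cancel₀ _ hx.ne']
        linarith
  have hgeo : ∑' j, ENNReal.ofReal (r ^ j * x) = ENNReal.ofReal ((1 - r)⁻¹ * x) := by
    rw [← ENNReal.ofReal_tsum_of_nonneg (fun j => by positivity)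
      ((summable_geometric_of_lt_one hr0.le hr1).mul_right x), tsum_mul_right,
      tsum_geometric_of_lt_one hr0.le hr1]
  have hhead : ∑ j ∈ Finset.range N, a j ≤ ∑ j ∈ Finset.range N, ENNReal.ofReal (K * x) :=
    Finset.sum_le_sum fun j _ => h1 j
  have htail : ∑' j, a (j + N) ≤ ∑' j, ENNReal.ofReal (r ^ j * x) := by
    refine ENNReal.tsum_le_tsum fun j => (h2 _).trans (ENNReal.ofReal_le_ofReal ?_)
    rw [pow_add, mul_assoc]
    exact mul_le_mul_of_nonneg_left hrN (by positivity)
  rw [← Summable.sum_add_tsum_nat_add' (f := a) (k := N) ENNReal.summable]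
  refine (add_le_add hhead htail).trans ?_
  clear_value N
  calc ∑ j ∈ Finset.range N, ENNReal.ofReal (K * x) + ∑' j, ENNReal.ofReal (r ^ j * x)
      = ENNReal.ofReal (N * (K * x) + (1 - r)⁻¹ * x) := by
        rw [hgeo, Finset.sum_const, Finset.card_range, nsmul_eq_mul,
          ENNReal.ofReal_add (by positivity) (by positivity), ENNReal.ofReal_mul (Nat.cast_nonneg N),
          ENNReal.ofReal_natCast]
    _ ≤ _ := by
        refine ENNReal.ofReal_le_ofReal ?_
        have h3 : (1 : ℝ) ≤ L / Real.log 2 := (one_le_div hl2).mpr hL2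
        have h4 : (N : ℝ) ≤ (1 / (s * Real.log 2) + 1 / Real.log 2) * L := by
          calc (N : ℝ) ≤ L / (s * Real.log 2) + L / Real.log 2 := by linarith
            _ = _ := by ring
        have h5 : (1 - r)⁻¹ * 1 ≤ (1 - r)⁻¹ * (L / Real.log 2) := by gcongr
        calc N * (K * x) + (1 - r)⁻¹ * x
            ≤ ((1 / (s * Real.log 2) + 1 / Real.log 2) * L) * (K * x)
              + (1 - r)⁻¹ * (L / Real.log 2) * x := by
              gcongr
              linarith
          _ = _ := by ring

theorem lpNorm_block_le_besovNorm (ρ : DyadicCutoff) (s : ℝ) (p : ℝ≥0∞) (f : 𝓢'(Plane, F)) (j : ℕ) :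
    lpNorm p (multiplier (ρ.block j) f) ≤
      ENNReal.ofReal (((2 : ℝ) ^ (-s)) ^ j) * besovNorm ρ s p f := by
  cases j with
  | zero =>
    simp only [pow_zero, ENNReal.ofReal_one, one_mul]
    exact le_self_add
  | succ j =>
    have h1 : ENNReal.ofReal ((2 : ℝ) ^ (((j + 1 : ℕ) : ℝ) * s)) *
        lpNorm p (multiplier (ρ.annulus (j + 1)) f) ≤ besovNorm ρ s p f :=
      (le_iSup₂_of_le (f := fun (j : ℕ) (_ : 1 ≤ j) => ENNReal.ofReal ((2 : ℝ) ^ ((j : ℝ) * s)) *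
        lpNorm p (multiplier (ρ.annulus j) f)) (j + 1) (by omega) le_rfl).trans le_add_self
    have e : ENNReal.ofReal (((2 : ℝ) ^ (-s)) ^ (j + 1)) *
        ENNReal.ofReal ((2 : ℝ) ^ (((j + 1 : ℕ) : ℝ) * s)) = 1 := by
      rw [← ENNReal.ofReal_mul (by positivity), ← Real.rpow_natCast, ← Real.rpow_mul two_pos.le,
        ← Real.rpow_add two_pos]
      ring_nf
      simp
    calc lpNorm p (multiplier (ρ.block (j + 1)) f)
        = ENNReal.ofReal (((2 : ℝ) ^ (-s)) ^ (j + 1)) *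
          (ENNReal.ofReal ((2 : ℝ) ^ (((j + 1 : ℕ) : ℝ) * s)) *
            lpNorm p (multiplier (ρ.annulus (j + 1)) f)) := by
          rw [← mul_assoc, e, one_mul, DyadicCutoff.block]
      _ ≤ _ := by gcongr

variable [CompleteSpace F]

variable (F) in
/-- The multiplier `symbol b σ` maps each Littlewood–Paley piece from `L^1` to `L^p`, `1/p = σ/2`,
with a constant independent of the frequency. -/
theorem exists_lpNorm_symbol_block_le (ρ : DyadicCutoff) {b σ : ℝ} (hb : 0 < b)
    {p : ℝ≥0∞} (hp : 1 ≤ p) (hpσ : p⁻¹.toReal = σ / 2) :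
    ∃ C : ℝ, 0 ≤ C ∧ ∀ (j : ℕ) (f : 𝓢'(Plane, F)), lpNorm 1 (multiplier (ρ.block j) f) ≠ ∞ →
      lpNorm p (multiplier (symbol b σ) (multiplier (ρ.block j) f)) ≤
        ENNReal.ofReal C * lpNorm 1 (multiplier (ρ.block j) f) := by
  have hpi := Real.pi_pos
  have hsym := symbol_hasTemperateGrowth hb σ
  obtain ⟨h, M, hh, hM⟩ := exists_rescaledSymbol_schwartz hb σ
  have hdisc : HasCompactSupport fun ξ => discBump ξ * symbol b σ ξ :=
    discBump.hasCompactSupport.mul_right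
  obtain ⟨h₀, hh₀⟩ := exists_schwartz_of_hasCompactSupport
    (hdisc.hasTemperateGrowth (discBump.contDiff.mul hsym.1)) hdisc
  obtain ⟨M₀, hM₀, hM₀'⟩ := exists_norm_fourierInv_le_single h₀
  have hM0 : 0 ≤ M := (norm_nonneg _).trans ((hM 0 (by simp)).1 0)
  have hM₀0 : 0 ≤ M₀ := (norm_nonneg _).trans (hM₀ 0)
  set κ : ℝ := (((2 * Real.pi) ^ 2)⁻¹) ^ (1 - σ / 2) with hκ
  have hκ0 : 0 ≤ κ := by positivity
  refine ⟨max M M₀ * κ, by positivity, fun j f hf => ?_⟩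
  cases j with
  | zero =>
    obtain ⟨n, hn⟩ := exists_dilation h₀ (l := 2 * Real.pi) (by positivity)
    have e := multiplier_multiplier_eq hsym (ρ.block_hasTemperateGrowth 0) n (fun ξ => ?_) f
    · rw [e]
      refine (lpNorm_fourierMultiplier_le (by positivity) hn hM₀ hM₀' hp _ hf).trans ?_
      rw [hpσ]
      gcongr
      exact le_max_right _ _
    · -- `discBump` is `1` on the support of the low-frequency cutoff
      rw [hn, hh₀, ← Complex.ofReal_mul, ← Complex.ofReal_mul, ← mul_assoc]
      exact congrArg _ (congrArg (· * _) (ρ.low_mul_discBump _))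
  | succ j =>
    set t : ℝ := 2⁻¹ ^ (j + 1) with ht
    have ht0 : 0 < t := by positivity
    have htI : t ∈ Set.Icc (0 : ℝ) 1 := ⟨ht0.le, pow_le_one₀ (by norm_num) (by norm_num)⟩
    obtain ⟨hMt, hMt'⟩ := hM t htI
    set c : ℝ := (t ^ 2) ^ (1 - σ / 2) with hc
    have hc0 : 0 < c := by positivity
    obtain ⟨n, hn⟩ := exists_dilation ((c : ℂ) • h t) (l := t * (2 * Real.pi)) (by positivity)
    have e := multiplier_multiplier_eq hsym (ρ.block_hasTemperateGrowth (j + 1)) n (fun ξ => ?_) f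
    · rw [e]
      have hcn : ‖(c : ℂ)‖ = c := by rw [Complex.norm_real, Real.norm_of_nonneg hc0.le]
      refine (lpNorm_fourierMultiplier_le (M := c * M) (by positivity) hn (fun x => ?_) ?_ hp _ hf).trans ?_
      · rw [FourierTransform.fourierInv_smul, smul_apply, norm_smul, hcn]
        gcongr
        exact hMt x
      · simp only [FourierTransform.fourierInv_smul, smul_apply, norm_smul, hcn]
        rw [integral_const_mul]
        gcongr
      · rw [hpσ]
        refine mul_le_mul_left (ENNReal.ofReal_le_ofReal ?_) _
        rw [mul_pow, mul_inv, Real.mul_rpow (by positivity) (by positivity), ← hκ,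
          Real.inv_rpow (by positivity), ← hc]
        -- the amplitude of the piece cancels the factor from the dilation of its kernel
        calc c * M * (c⁻¹ * κ) = M * κ := by field_simp
          _ ≤ _ := by gcongr; exact le_max_left _ _
    · rw [hn, smul_apply, hh, smul_eq_mul, mul_smul t, ← Complex.ofReal_mul, ← Complex.ofReal_mul,
        ← Complex.ofReal_mul]
      exact congrArg _ (ρ.annulus_mul_symbol b σ (j + 1) _)

variable (F) in
/-- The Littlewood–Paley projections are uniformly bounded on `L^1`. -/
theorem exists_lpNorm_block_le (ρ : DyadicCutoff) :
    ∃ C : ℝ, 0 ≤ C ∧ ∀ (j : ℕ) (f : 𝓢'(Plane, F)), lpNorm 1 f ≠ ∞ →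
      lpNorm 1 (multiplier (ρ.block j) f) ≤ ENNReal.ofReal C * lpNorm 1 f := by
  have hpi := Real.pi_pos
  obtain ⟨h₀, hh₀⟩ := exists_schwartz_of_hasCompactSupport ρ.low_hasTemperateGrowth
    ρ.low_hasCompactSupport
  obtain ⟨h, hh⟩ := exists_schwartz_of_hasCompactSupport ρ.toSchwartz.hasTemperateGrowth
    ρ.toSchwartz_hasCompactSupport
  obtain ⟨M₀, hM₀, hM₀'⟩ := exists_norm_fourierInv_le_single h₀
  obtain ⟨M, hM, hM'⟩ := exists_norm_fourierInv_le_single h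
  have hM0 : 0 ≤ M := (norm_nonneg _).trans (hM 0)
  refine ⟨max M M₀, le_max_of_le_left hM0, fun j f hf => ?_⟩
  cases j with
  | zero =>
    obtain ⟨n, hn⟩ := exists_dilation h₀ (l := 2 * Real.pi) (by positivity)
    have e : multiplier (ρ.block 0) f = TemperedDistribution.fourierMultiplierCLM F n f := by
      rw [multiplier]
      congr 2
      ext ξ
      rw [hn, hh₀, DyadicCutoff.block]
    rw [e]
    refine (lpNorm_fourierMultiplier_le (by positivity) hn hM₀ hM₀' le_rfl _ hf).trans ?_
    gcongr
    simp
  | succ j =>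
    obtain ⟨n, hn⟩ := exists_dilation h (l := (2 : ℝ) ^ (-((j + 1 : ℕ) : ℤ)) * (2 * Real.pi)) (by positivity)
    have e : multiplier (ρ.block (j + 1)) f = TemperedDistribution.fourierMultiplierCLM F n f := by
      rw [multiplier]
      congr 2
      ext ξ
      rw [hn, hh, DyadicCutoff.block, DyadicCutoff.annulus, mul_smul ((2 : ℝ) ^ _)]
    rw [e]
    refine (lpNorm_fourierMultiplier_le (by positivity) hn hM hM' le_rfl _ hf).trans ?_
    gcongr
    simp

theorem lpNorm_one_lt_top_of_besovNorm {ρ : DyadicCutoff} {s : ℝ} (hs : 0 < s) {f : 𝓢'(Plane, F)}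
    (hf : besovNorm ρ s 1 f < ∞) : lpNorm 1 f < ∞ := by
  have hr1 : (2 : ℝ) ^ (-s) < 1 := Real.rpow_lt_one_of_one_lt_of_neg one_lt_two (by linarith)
  refine (lpNorm_le_tsum (tendsto_sum_block ρ f)).trans_lt ?_
  refine (ENNReal.tsum_le_tsum fun j => lpNorm_block_le_besovNorm ρ s 1 f j).trans_lt ?_
  rw [ENNReal.tsum_mul_right]
  refine ENNReal.mul_lt_top ?_ hf
  exact (summable_geometric_of_lt_one (by positivity) hr1).tsum_ofReal_lt_top

variable (F) in
/-- The logarithmic estimate for `(b - Δ)⁻¹ (1 - Δ)^{σ/2}` in `L^p` with `1/p = σ/2`. -/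
theorem exists_lpNorm_symbol_le_log (ρ : DyadicCutoff) {b s σ : ℝ} (hb : 0 < b) (hs : 0 < s)
    {p : ℝ≥0∞} (hp : 1 ≤ p) (hpσ : p⁻¹.toReal = σ / 2) :
    ∃ C : ℝ, 0 ≤ C ∧ ∀ f : 𝓢'(Plane, F), besovNorm ρ s 1 f < ∞ →
      lpNorm p (multiplier (symbol b σ) f) ≤
        ENNReal.ofReal (C * (lpNorm 1 f).toReal *
          Real.log (2 + (besovNorm ρ s 1 f).toReal / (lpNorm 1 f).toReal)) := by
  obtain ⟨C₁, hC₁, h₁⟩ := exists_lpNorm_symbol_block_le F ρ hb hp hpσ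
  obtain ⟨K, hK, h₂⟩ := exists_lpNorm_block_le F ρ
  obtain ⟨C₂, hC₂, h₃⟩ := tsum_le_log hs hK
  refine ⟨C₁ * C₂, by positivity, fun f hf => ?_⟩
  have hf1 := lpNorm_one_lt_top_of_besovNorm hs hf
  have hfj : ∀ j, lpNorm 1 (multiplier (ρ.block j) f) ≠ ∞ := fun j =>
    ((h₂ j f hf1.ne).trans_lt (ENNReal.mul_lt_top ENNReal.ofReal_lt_top hf1)).ne
  have : Fact (1 ≤ p) := ⟨hp⟩
  calc lpNorm p (multiplier (symbol b σ) f)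
      ≤ ∑' j, lpNorm p (multiplier (symbol b σ) (multiplier (ρ.block j) f)) :=
        lpNorm_le_tsum fun φ => tendsto_sum_block ρ f _
    _ ≤ ∑' j, ENNReal.ofReal C₁ * lpNorm 1 (multiplier (ρ.block j) f) :=
        ENNReal.tsum_le_tsum fun j => h₁ j f (hfj j)
    _ = ENNReal.ofReal C₁ * ∑' j, lpNorm 1 (multiplier (ρ.block j) f) := ENNReal.tsum_mul_left
    _ ≤ ENNReal.ofReal C₁ * ENNReal.ofReal (C₂ * (lpNorm 1 f).toReal *
          Real.log (2 + (besovNorm ρ s 1 f).toReal / (lpNorm 1 f).toReal)) := by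
        gcongr
        refine h₃ _ _ _ ENNReal.toReal_nonneg ENNReal.toReal_nonneg (fun j => ?_) fun j => ?_
        · rw [ENNReal.ofReal_mul hK, ENNReal.ofReal_toReal hf1.ne]
          exact h₂ j f hf1.ne
        · rw [ENNReal.ofReal_mul (by positivity), ENNReal.ofReal_toReal hf.ne]
          exact lpNorm_block_le_besovNorm ρ s 1 f j
    _ = _ := by
        rw [← ENNReal.ofReal_mul hC₁]
        ring_nf

end

end BrezisGallouet

theorem theorem2 {F : Type*} [NormedAddCommGroup F] [NormedSpace ℂ F] [CompleteSpace F]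
    (ρ : BrezisGallouet.DyadicCutoff) (b s : ℝ) (hb : 0 < b) (hs : 0 < s) :
    ∃ C : ℝ, 0 < C ∧ ∀ f : 𝓢'(BrezisGallouet.Plane, F),
      BrezisGallouet.besovNorm ρ s 1 f < ∞ →
        BrezisGallouet.lpNorm 1 f < ∞ ∧
        BrezisGallouet.lpNorm ∞ (BrezisGallouet.resolvent b f) ≤
          ENNReal.ofReal (C * (BrezisGallouet.lpNorm 1 f).toReal *
            Real.log (2 + (BrezisGallouet.besovNorm ρ s 1 f).toReal /
              (BrezisGallouet.lpNorm 1 f).toReal)) ∧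
        (s ≤ 2 →
          BrezisGallouet.lpNorm ∞ (BrezisGallouet.resolvent b f) +
            BrezisGallouet.lpNorm (ENNReal.ofReal (2 / s))
              (BrezisGallouet.resolvent b (BrezisGallouet.bessel s f)) ≤
          ENNReal.ofReal (C * (BrezisGallouet.lpNorm 1 f).toReal *
            Real.log (2 + (BrezisGallouet.besovNorm ρ s 1 f).toReal /
              (BrezisGallouet.lpNorm 1 f).toReal))) := by
  open BrezisGallouet in
  obtain ⟨C₁, hC₁, h₁⟩ := exists_lpNorm_symbol_le_log F ρ hb hs (σ := 0) (p := ∞) le_top (by simp)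
  obtain ⟨C₂, hC₂, h₂⟩ : ∃ C₂ : ℝ, 0 ≤ C₂ ∧ ∀ f : 𝓢'(Plane, F), besovNorm ρ s 1 f < ∞ → s ≤ 2 →
      lpNorm (ENNReal.ofReal (2 / s)) (resolvent b (bessel s f)) ≤
        ENNReal.ofReal (C₂ * (lpNorm 1 f).toReal *
          Real.log (2 + (besovNorm ρ s 1 f).toReal / (lpNorm 1 f).toReal)) := by
    rcases le_or_gt s 2 with hs2 | hs2
    · obtain ⟨C₂, hC₂, h₂⟩ := exists_lpNorm_symbol_le_log F ρ hb hs (σ := s)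
        (p := ENNReal.ofReal (2 / s)) (by simpa using (one_le_div hs).mpr hs2)
        (by rw [ENNReal.toReal_inv, ENNReal.toReal_ofReal (by positivity), inv_div])
      exact ⟨C₂, hC₂, fun f hf _ => resolvent_bessel hb s f ▸ h₂ f hf⟩
    · exact ⟨0, le_rfl, fun f _ h => absurd h (not_le.mpr hs2)⟩
  refine ⟨C₁ + C₂ + 1, by positivity, fun f hf => ?_⟩
  have hlog : 0 ≤ (lpNorm 1 f).toReal *
      Real.log (2 + (besovNorm ρ s 1 f).toReal / (lpNorm 1 f).toReal) := by
    refine mul_nonneg ENNReal.toReal_nonneg (Real.log_nonneg ?_)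
    have : 0 ≤ (besovNorm ρ s 1 f).toReal / (lpNorm 1 f).toReal := by positivity
    linarith
  have h₁' := h₁ f hf
  rw [← resolvent_eq_multiplier_symbol] at h₁'
  refine ⟨lpNorm_one_lt_top_of_besovNorm hs hf, h₁'.trans (ENNReal.ofReal_le_ofReal ?_), fun hs2 => ?_⟩
  · rw [mul_assoc, mul_assoc]
    exact mul_le_mul_of_nonneg_right (by linarith) hlog
  · refine (add_le_add h₁' (h₂ f hf hs2)).trans ?_
    rw [← ENNReal.ofReal_add (by rw [mul_assoc]; positivity) (by rw [mul_assoc]; positivity)]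
    refine ENNReal.ofReal_le_ofReal ?_
    rw [mul_assoc, mul_assoc, mul_assoc, ← add_mul]
    exact mul_le_mul_of_nonneg_right (by linarith) hlog
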